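/- Let $K\ge 1$ and let $\mathcal S\subset\mathbb R^q$ be any subset. A $K$-state hidden Markov model with parameters $(\Gamma;F_1,\dots,F_K)$ consists of a time-homogeneous Markov chain $(X_t)_{t\in\mathbb N}$ with values in $\{1,\dots,K\}$ and transition probability matrix $\Gamma$, and of $\mathcal S$-valued observations $(Y_t)_{t\in\mathbb N}$ that are conditionally independent given $(X_t)_{t\in\mathbb N}$, such that the conditional distribution of $Y_s$ given $(X_t)_{t\in\mathbb N}$ is $F_{X_s}$, where the state-dependent distributions $F_1,\dots,F_K$ are probability distributions on $\mathcal S$ (Borel $\sigma$-algebra). Consider the following assumptions: 1. $\Gamma$ has full rank $K$ and is ergodic (irreducible and aperiodic); 2. $F_1,\dots,F_K$ are pairwise distinct; 3. $(X_t)$ is stationary, i.e. $X_1$ is distributed according to the stationary distribution $\pi$ of $\Gamma$. Proposition. For known $K$, the parameters $\Gamma$ and $F_1,\dots,F_K$ are identified, up to label swapping, from the joint distribution of $(Y_1,\dots,Y_{2K+1})$ within the class of parameters satisfying Assumptions 1–3. That is: if two $K$-state hidden Markov models with values in $\mathcal S$, with parameters $(\Gamma;F_1,\dots,F_K)$ and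 $(\Gamma';F'_1,\dots,F'_K)$, both satisfy Assumptions 1–3 and give the same joint distribution of $(Y_1,\dots,Y_{2K+1})$, then there is a permutation $\sigma$ of $\{1,\dots,K\}$ such that $F'_k=F_{\sigma(k)}$ and $\Gamma'_{jk}=\Gamma_{\sigma(j)\sigma(k)}$ for all $j,k\in\{1,\dots,K\}$. -/

import Mathlib

open MeasureTheory ProbabilityTheory

/-- Label swapping: the parameters `(Γ', F')` arise from `(Γ, F)` by a permutation of the labels
of the `K` states. -/
def EqualUpToLabelSwapping {K : ℕ} {S : Type*} [MeasurableSpace S]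
    (Γ : Matrix (Fin K) (Fin K) ℝ) (F : Fin K → Measure S)
    (Γ' : Matrix (Fin K) (Fin K) ℝ) (F' : Fin K → Measure S) : Prop :=
  ∃ σ : Equiv.Perm (Fin K),
    (∀ j k, Γ' j k = Γ (σ j) (σ k)) ∧ ∀ k, F' k = F (σ k)

/-- A transition matrix is aperiodic if, for every state `i`, the return times to `i`, that is the
`n ≥ 1` with `(Γ ^ n) i i > 0`, have greatest common divisor `1`. -/
def IsAperiodicMatrix {K : ℕ} (Γ : Matrix (Fin K) (Fin K) ℝ) : Prop :=
  ∀ (i : Fin K) (d : ℕ), (∀ n : ℕ, 1 ≤ n → 0 < (Γ ^ n) i i → d ∣ n) → d = 1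

/-- Ergodicity of a finite transition matrix: irreducible and aperiodic. -/
def IsErgodicMatrix {K : ℕ} (Γ : Matrix (Fin K) (Fin K) ℝ) : Prop :=
  Γ.IsIrreducible ∧ IsAperiodicMatrix Γ

/-- `p` is a stationary distribution of `Γ`: a probability vector with `p Γ = p`. -/
structure IsStationaryDistribution {K : ℕ} (Γ : Matrix (Fin K) (Fin K) ℝ) (p : Fin K → ℝ) :
    Prop where
  nonneg : ∀ k, 0 ≤ p k
  sum_eq_one : ∑ k, p k = 1
  vecMul_eq : Matrix.vecMul p Γ = p

/-- `X 0, X 1, X 2, …` is a time-homogeneous Markov chain on `Fin K` with transition probability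
matrix `Γ` and some starting distribution. The Markov property is written in the multiplied-out form
`pr (X_{n+1} = x_{n+1}, X_n = x_n, …, X_0 = x_0) = pr (X_n = x_n, …, X_0 = x_0) Γ x_n x_{n+1}`. -/
structure IsMarkovChain {K : ℕ} {Ω : Type*} [MeasurableSpace Ω]
    (Γ : Matrix (Fin K) (Fin K) ℝ) (μ : Measure Ω) (X : ℕ → Ω → Fin K) : Prop where
  stochastic : Γ ∈ Matrix.rowStochastic ℝ (Fin K)
  measurable : ∀ t, Measurable (X t)
  markov : ∀ (n : ℕ) (x : ℕ → Fin K),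
    μ.real {ω | ∀ i ≤ n + 1, X i ω = x i} =
      μ.real {ω | ∀ i ≤ n, X i ω = x i} * Γ (x n) (x (n + 1))

/-- The σ-algebra generated by the whole process `(X t)_{t ∈ ℕ}`. -/
abbrev processSigma {K : ℕ} {Ω : Type*} (X : ℕ → Ω → Fin K) : MeasurableSpace Ω :=
  ⨆ t, MeasurableSpace.comap (X t) inferInstance

/-- `(X t, Y t)_{t ∈ ℕ}` is a `K`-state hidden Markov model under `μ`, with transition matrix `Γ` and
state-dependent distributions `F k`: the latent process `X` is a time-homogeneous Markov chain, the
`Y t` are conditionally independent given `(X t)_{t ∈ ℕ}`, and the conditional distribution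
of `Y t` given `(X t)_{t ∈ ℕ}` is `F (X t)`. Times start at `0` instead of `1`. -/
structure IsHiddenMarkovModel {K : ℕ} {S : Type*} [MeasurableSpace S]
    {Ω : Type*} [MeasurableSpace Ω]
    (Γ : Matrix (Fin K) (Fin K) ℝ) (F : Fin K → Measure S) (μ : Measure Ω)
    (X : ℕ → Ω → Fin K) (Y : ℕ → Ω → S) : Prop where
  isProbabilityMeasure : ∀ k, IsProbabilityMeasure (F k)
  markovChain : IsMarkovChain Γ μ X
  measurable : ∀ t, Measurable (Y t)
  condIndep : ∀ (s : Finset ℕ) (B : ℕ → Set S), (∀ t, MeasurableSet (B t)) →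
    μ⟦⋂ t ∈ s, Y t ⁻¹' B t | processSigma X⟧
      =ᵐ[μ] fun ω => ∏ t ∈ s, (μ⟦Y t ⁻¹' B t | processSigma X⟧) ω
  condDistrib : ∀ (t : ℕ) (B : Set S), MeasurableSet B →
    μ⟦Y t ⁻¹' B | processSigma X⟧ =ᵐ[μ] fun ω => (F (X t ω)).real B

/-- The first assumption: the transition matrix has full rank and is ergodic. -/
def FullRankErgodic {K : ℕ} (Γ : Matrix (Fin K) (Fin K) ℝ) : Prop :=
  Γ.rank = K ∧ IsErgodicMatrix Γ

/-- The third assumption: the starting distribution of the chain is the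
stationary distribution of `Γ`. -/
def StartsStationary {K : ℕ} {Ω : Type*} [MeasurableSpace Ω]
    (Γ : Matrix (Fin K) (Fin K) ℝ) (μ : Measure Ω) (X : ℕ → Ω → Fin K) : Prop :=
  IsStationaryDistribution Γ fun k => μ.real (X 0 ⁻¹' {k})

/-!
Fix the alphabet of measurable subsets of `S`. With `D A` the diagonal matrix of the emission
probabilities `F k A` and `p` the starting distribution, the probability of `Y 0 ∈ A 0`, …,
`Y (n - 1) ∈ A (n - 1)` is `p * D (A 0) * Γ * ⋯ * D (A (n - 1)) * Γ * 1`, which is the output of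
the linear system with initial state `1`, output functional `p` and one transition map
`D A * Γ` for each letter `A`.

The functions `k ↦ F k A` separate the states, so they generate the algebra `Fin K → ℝ`. As `Γ` is
invertible, a subspace stable under all `D A * Γ` is then stable under multiplication by every
function, hence it is everything if it contains `1`, and zero if `p` vanishes on it. Counting
dimensions, words of length less than `K` already reach every state and tell all states apart, so
the output on the words of length less than `2 * K` determines the system up to a linear
equivalence `T`.

This `T` fixes `1`, carries `Γ` to `Γ'` and carries multiplication by `k ↦ F k A` to multiplication
by `k ↦ F' k A`. It is therefore multiplicative, and an algebra automorphism of `Fin K → ℝ` permutes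
the coordinates.
-/

open Module Matrix

section LinearSystem

theorem eq_zero_of_antitone_of_stable {δ : ℕ → ℕ} (hδ : Antitone δ)
    (hstable : ∀ m, δ (m + 1) = δ m → δ m = 0) {d : ℕ} (hd : δ 0 ≤ d) : δ d = 0 := by
  have bound (m : ℕ) : δ m ≤ d - m := by
    induction m with
    | zero => exact hd
    | succ m ih =>
      have := hδ m.le_succ
      have := hstable m
      lia
  simpa using bound d

variable {𝕜 E E' ι : Type*} [Field 𝕜] [AddCommGroup E] [Module 𝕜 E] [AddCommGroup E'] [Module 𝕜 E']

/-- The span of the states reached from the initial state `v` of the linear system with transition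
maps `f a` by words of length less than `m`. The last letter of a word acts first. -/
def reachableSubspace (f : ι → End 𝕜 E) (v : E) (m : ℕ) : Submodule 𝕜 E :=
  Submodule.span 𝕜 (Set.range fun w : {w : List ι // w.length < m} => (w.1.map f).prod v)

/-- The states of the linear system with transition maps `f a` and output functional `φ` on which
the output vanishes after every word of length less than `m`. -/
def unobservableSubspace (f : ι → End 𝕜 E) (φ : Dual 𝕜 E) (m : ℕ) : Submodule 𝕜 E :=
  ⨅ w : {w : List ι // w.length < m}, LinearMap.ker (φ ∘ₗ (w.1.map f).prod)

variable {f : ι → End 𝕜 E} {v : E} {φ : Dual 𝕜 E} {m : ℕ} {x : E}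

theorem reachableSubspace_mono : Monotone (reachableSubspace f v) := fun _ _ hmn =>
  Submodule.span_mono <| Set.range_subset_iff.2 fun w => ⟨⟨w.1, w.2.trans_le hmn⟩, rfl⟩

theorem mem_reachableSubspace_succ : v ∈ reachableSubspace f v (m + 1) :=
  Submodule.subset_span ⟨⟨[], m.succ_pos⟩, rfl⟩

theorem apply_mem_reachableSubspace_succ (a : ι) (hx : x ∈ reachableSubspace f v m) :
    f a x ∈ reachableSubspace f v (m + 1) := by
  have h : reachableSubspace f v m ≤ (reachableSubspace f v (m + 1)).comap (f a) :=
    Submodule.span_le.2 <| Set.range_subset_iff.2 fun w =>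
      Submodule.subset_span ⟨⟨a :: w.1, Nat.succ_lt_succ w.2⟩, by simp⟩
  exact h hx

theorem mem_unobservableSubspace :
    x ∈ unobservableSubspace f φ m ↔ ∀ w : List ι, w.length < m → φ ((w.map f).prod x) = 0 := by
  simp [unobservableSubspace]

theorem unobservableSubspace_antitone : Antitone (unobservableSubspace f φ) := fun _ _ hmn _ hx =>
  mem_unobservableSubspace.2 fun w hw => mem_unobservableSubspace.1 hx w (hw.trans_le hmn)

theorem unobservableSubspace_succ_le_ker :
    unobservableSubspace f φ (m + 1) ≤ LinearMap.ker φ := fun _ hx =>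
  mem_unobservableSubspace.1 hx [] m.succ_pos

theorem apply_mem_unobservableSubspace (a : ι) (hx : x ∈ unobservableSubspace f φ (m + 1)) :
    f a x ∈ unobservableSubspace f φ m :=
  mem_unobservableSubspace.2 fun w hw => by
    simpa using mem_unobservableSubspace.1 hx (w ++ [a]) (by simpa using hw)

theorem reachableSubspace_finrank_eq_top [FiniteDimensional 𝕜 E]
    (h : ∀ W : Submodule 𝕜 E, v ∈ W → (∀ a, ∀ x ∈ W, f a x ∈ W) → W = ⊤) :
    reachableSubspace f v (finrank 𝕜 E) = ⊤ := by
  set V := reachableSubspace f v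
  have hstable (m : ℕ) (hm : V m = V (m + 1)) : V m = ⊤ :=
    h _ (hm ▸ mem_reachableSubspace_succ) fun a _ hx => hm ▸ apply_mem_reachableSubspace_succ a hx
  have hmono : Monotone V := reachableSubspace_mono
  have hle (m : ℕ) : finrank 𝕜 (V m) ≤ finrank 𝕜 E := (V m).finrank_le
  have hcodim : finrank 𝕜 E - finrank 𝕜 (V (finrank 𝕜 E)) = 0 := by
    refine eq_zero_of_antitone_of_stable (δ := fun m => finrank 𝕜 E - finrank 𝕜 (V m))
      (fun m n hmn => Nat.sub_le_sub_left (Submodule.finrank_mono (hmono hmn)) _)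
      (fun m hm => ?_) (Nat.sub_le _ _)
    have hfin : finrank 𝕜 (V m) = finrank 𝕜 (V (m + 1)) := by
      have := hle m
      have := hle (m + 1)
      lia
    have htop : V m = ⊤ := hstable m (Submodule.eq_of_le_of_finrank_eq (hmono m.le_succ) hfin)
    exact Nat.sub_eq_zero_of_le (by rw [htop, finrank_top])
  exact Submodule.eq_top_of_finrank_eq <| (hle _).antisymm (Nat.sub_eq_zero_iff_le.1 hcodim)

theorem unobservableSubspace_finrank_eq_bot [FiniteDimensional 𝕜 E]
    (h : ∀ W : Submodule 𝕜 E, W ≤ LinearMap.ker φ → (∀ a, ∀ x ∈ W, f a x ∈ W) → W = ⊥) :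
    unobservableSubspace f φ (finrank 𝕜 E) = ⊥ := by
  set V := unobservableSubspace f φ
  have hstable (m : ℕ) (hm : V (m + 1) = V m) : V m = ⊥ :=
    h _ (hm ▸ unobservableSubspace_succ_le_ker) fun a _ hx =>
      apply_mem_unobservableSubspace a (hm.ge hx)
  have hanti : Antitone V := unobservableSubspace_antitone
  refine Submodule.finrank_eq_zero.1 <| eq_zero_of_antitone_of_stable
    (δ := fun m => finrank 𝕜 (V m)) (fun m n hmn => Submodule.finrank_mono (hanti hmn))
    (fun m hm => ?_) (V 0).finrank_le
  rw [hstable m (Submodule.eq_of_le_of_finrank_eq (hanti m.le_succ) hm), finrank_bot]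

theorem exists_linearEquiv_of_comp_eq_comp {P Q : Type*} [AddCommGroup P] [Module 𝕜 P]
    [AddCommGroup Q] [Module 𝕜 Q] [FiniteDimensional 𝕜 E] [FiniteDimensional 𝕜 E']
    (hdim : finrank 𝕜 E = finrank 𝕜 E') {R : P →ₗ[𝕜] E} {O : E →ₗ[𝕜] Q} {R' : P →ₗ[𝕜] E'}
    {O' : E' →ₗ[𝕜] Q} (hR : Function.Surjective R) (hO : Function.Injective O)
    (h : O ∘ₗ R = O' ∘ₗ R') :
    Function.Injective O' ∧ ∃ T : E ≃ₗ[𝕜] E', (∀ x, T (R x) = R' x) ∧ ∀ x, O' (T x) = O x := by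
  obtain ⟨s, hs⟩ := R.exists_rightInverse_of_surjective (LinearMap.range_eq_top.2 hR)
  have hO'T (x : E) : O' (R' (s x)) = O x := by
    rw [← LinearMap.comp_apply O', ← h, LinearMap.comp_apply, ← LinearMap.comp_apply R, hs,
      LinearMap.id_apply]
  have hinj : Function.Injective (R' ∘ₗ s) :=
    Function.Injective.of_comp (f := O') (by simpa [Function.comp_def, hO'T] using hO)
  let T : E ≃ₗ[𝕜] E' := (R' ∘ₗ s).linearEquivOfInjective hinj hdim
  have hO' : Function.Injective O' := by
    refine (Function.Injective.of_comp_iff' O' T.bijective).1 ?_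
    simpa [Function.comp_def, T, hO'T] using hO
  refine ⟨hO', T, fun x => hO' ?_, hO'T⟩
  exact (hO'T (R x)).trans (LinearMap.congr_fun h x)

theorem exists_linearEquiv_intertwining [FiniteDimensional 𝕜 E] [FiniteDimensional 𝕜 E']
    (hdim : finrank 𝕜 E = finrank 𝕜 E') {f' : ι → End 𝕜 E'} {v' : E'} {φ' : Dual 𝕜 E'}
    (hv : reachableSubspace f v m = ⊤) (hφ : unobservableSubspace f φ m = ⊥)
    (h : ∀ w : List ι, w.length < 2 * m →
      φ ((w.map f).prod v) = φ' ((w.map f').prod v')) :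
    ∃ T : E ≃ₗ[𝕜] E', T v = v' ∧ ∀ a x, T (f a x) = f' a (T x) := by
  let W := {w : List ι // w.length < m}
  let R : (W →₀ 𝕜) →ₗ[𝕜] E := Finsupp.linearCombination 𝕜 fun w => (w.1.map f).prod v
  let R' : (W →₀ 𝕜) →ₗ[𝕜] E' := Finsupp.linearCombination 𝕜 fun w => (w.1.map f').prod v'
  let O : E →ₗ[𝕜] W → 𝕜 := LinearMap.pi fun w => φ ∘ₗ (w.1.map f).prod
  let O' : E' →ₗ[𝕜] W → 𝕜 := LinearMap.pi fun w => φ' ∘ₗ (w.1.map f').prod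
  have hR : LinearMap.range R = ⊤ := (Finsupp.range_linearCombination 𝕜).trans hv
  have hO : LinearMap.ker O = ⊥ := (LinearMap.ker_pi _).trans hφ
  have hOR : O ∘ₗ R = O' ∘ₗ R' := by
    ext z w
    have := h (w.1 ++ z.1) (by grind)
    simpa [R, R', O, O'] using this
  have hOfR (a : ι) : O ∘ₗ f a ∘ₗ R = O' ∘ₗ f' a ∘ₗ R' := by
    ext z w
    have := h (w.1 ++ a :: z.1) (by grind)
    simpa [R, R', O, O'] using this
  obtain ⟨hO', T, hTR, hO'T⟩ := exists_linearEquiv_of_comp_eq_comp hdim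
    (LinearMap.range_eq_top.1 hR) (LinearMap.ker_eq_bot.1 hO) hOR
  refine ⟨T, hO' ?_, fun a x => hO' ?_⟩
  · rw [hO'T]
    ext w
    exact h w.1 (by grind)
  · obtain ⟨y, rfl⟩ := LinearMap.range_eq_top.1 hR x
    rw [hO'T, hTR]
    exact LinearMap.congr_fun (hOfR a) y

end LinearSystem

section FunctionAlgebra

variable {𝕜 n ι : Type*} [Field 𝕜]

theorem adjoin_eq_top_of_separatesPoints [Finite n] {s : Set (n → 𝕜)} (hs : s.SeparatesPoints) :
    Algebra.adjoin 𝕜 s = ⊤ := by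
  classical
  cases nonempty_fintype n
  set A := Algebra.adjoin 𝕜 s
  have hpair (k j : n) : ∃ g ∈ A, g k = 1 ∧ (j ≠ k → g j = 0) := by
    rcases eq_or_ne j k with rfl | hjk
    · exact ⟨1, A.one_mem, rfl, fun h => absurd rfl h⟩
    · obtain ⟨g, hg, hne⟩ := hs hjk
      refine ⟨(g k - g j)⁻¹ • (g - algebraMap 𝕜 _ (g j)), A.smul_mem (A.sub_mem
        (Algebra.subset_adjoin hg) (A.algebraMap_mem _)) _, ?_, fun _ => ?_⟩
      · simp [sub_ne_zero.2 hne.symm]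
      · simp
  have hsingle (k : n) : Pi.single k 1 ∈ A := by
    choose g hg hg1 hg0 using hpair k
    have : Pi.single k 1 = ∏ j, g j := by
      ext i
      rcases eq_or_ne i k with rfl | hik
      · simp [hg1]
      · rw [Pi.single_eq_of_ne hik, Finset.prod_apply]
        exact (Finset.prod_eq_zero (f := fun j => g j i) (Finset.mem_univ i) (hg0 i hik)).symm
    exact this ▸ A.prod_mem fun j _ => hg j
  refine eq_top_iff.2 fun g _ => ?_
  rw [pi_eq_sum_univ' g]
  exact A.sum_mem fun k _ => A.smul_mem (by convert hsingle k using 1) _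

theorem mul_mem_of_separatesPoints [Finite n] {s : Set (n → 𝕜)} (hs : s.SeparatesPoints)
    {W : Submodule 𝕜 (n → 𝕜)} (hW : ∀ g ∈ s, ∀ x ∈ W, g * x ∈ W) (g : n → 𝕜) {x : n → 𝕜}
    (hx : x ∈ W) : g * x ∈ W := by
  have hg : g ∈ Algebra.adjoin 𝕜 s := adjoin_eq_top_of_separatesPoints hs ▸ Algebra.mem_top
  induction hg using Algebra.adjoin_induction generalizing x with
  | mem g hg => exact hW g hg x hx
  | algebraMap r => simpa [← Algebra.smul_def] using W.smul_mem r hx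
  | add g h _ _ hg hh => exact add_mul g h x ▸ W.add_mem (hg hx) (hh hx)
  | mul g h _ _ hg hh => exact mul_assoc g h x ▸ hg (hh hx)

theorem exists_perm_forall_algEquiv_apply_eq {R : Type*} [CommSemiring R] [NoZeroDivisors R]
    [Nontrivial R] [Finite n] (T : (n → R) ≃ₐ[R] (n → R)) :
    ∃ σ : Equiv.Perm n, ∀ g, T g = g ∘ σ := by
  classical
  choose σ hσ using fun k =>
    ((Pi.evalAlgHom R (fun _ : n => R) k).comp T.toAlgHom).eq_piEvalAlgHom
  have hT (g : n → R) : T g = g ∘ σ := funext fun k => DFunLike.congr_fun (hσ k) g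
  have hsurj : Function.Surjective σ := by
    intro j
    by_contra! h
    have hj : T (Pi.single j 1) = T 0 := by
      ext k
      simp [hT, h k]
    simpa using congrFun (T.injective hj) j
  exact ⟨.ofBijective σ (Finite.surjective_iff_bijective.1 hsurj), hT⟩

theorem exists_perm_of_linearEquiv_mul [Finite n] {T : (n → 𝕜) ≃ₗ[𝕜] (n → 𝕜)} (hT1 : T 1 = 1)
    {d d' : ι → n → 𝕜} (hd : (Set.range d).SeparatesPoints)
    (hTd : ∀ a x, T (d a * x) = d' a * T x) :
    ∃ σ : Equiv.Perm n, (∀ x, T x = x ∘ σ) ∧ ∀ a, d' a = d a ∘ σ := by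
  have hd' (a : ι) : d' a = T (d a) := by simpa [hT1] using (hTd a 1).symm
  have hmul (g x : n → 𝕜) : T (g * x) = T g * T x := by
    have hg : g ∈ Algebra.adjoin 𝕜 (Set.range d) :=
      adjoin_eq_top_of_separatesPoints hd ▸ Algebra.mem_top
    induction hg using Algebra.adjoin_induction generalizing x with
    | mem g hg =>
      obtain ⟨a, rfl⟩ := hg
      rw [hTd, hd']
    | algebraMap r => simp [Algebra.algebraMap_eq_smul_one, hT1]
    | add g h _ _ hg hh => rw [add_mul, map_add, hg, hh, map_add, add_mul]
    | mul g h _ _ hg hh => rw [mul_assoc, hg, hh, hg, mul_assoc]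
  obtain ⟨σ, hσ⟩ := exists_perm_forall_algEquiv_apply_eq (AlgEquiv.ofLinearEquiv T hT1 hmul)
  exact ⟨σ, hσ, fun a => (hd' a).trans (hσ _)⟩

end FunctionAlgebra

section WeightedStep

variable {𝕜 n ι : Type*} [Field 𝕜] [Fintype n]

/-- The endomorphism `x ↦ g * Γ x` of `n → 𝕜`, that is the matrix `diagonal g * Γ`: one step of a
Markov chain with transition matrix `Γ`, weighted by `g` at the state it leaves. -/
def weightedStep (Γ : Matrix n n 𝕜) (g : n → 𝕜) : End 𝕜 (n → 𝕜) :=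
  LinearMap.mulLeft 𝕜 g ∘ₗ Γ.mulVecLin

@[simp]
theorem weightedStep_apply (Γ : Matrix n n 𝕜) (g x : n → 𝕜) :
    weightedStep Γ g x = g * Γ *ᵥ x :=
  rfl

variable [DecidableEq n] {Γ : Matrix n n 𝕜} {d : ι → n → 𝕜} {e : ι}

theorem mul_mem_of_forall_weightedStep_mem (hΓ : IsUnit Γ) (hd : (Set.range d).SeparatesPoints)
    (he : d e = 1) {W : Submodule 𝕜 (n → 𝕜)} (hW : ∀ a, ∀ x ∈ W, weightedStep Γ (d a) x ∈ W)
    (g : n → 𝕜) {x : n → 𝕜} (hx : x ∈ W) : g * x ∈ W := by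
  have hΓW : ∀ x ∈ W, Γ.mulVecLin x ∈ W := fun x hx => by simpa [he] using hW e x hx
  have hinj : Function.Injective (Γ.mulVecLin.restrict hΓW) := fun y z hyz =>
    Subtype.ext (Matrix.mulVec_injective_iff_isUnit.2 hΓ (congrArg Subtype.val hyz))
  refine mul_mem_of_separatesPoints hd (Set.forall_mem_range.2 fun a x hx => ?_) g hx
  obtain ⟨y, hy⟩ := LinearMap.surjective_of_injective hinj ⟨x, hx⟩
  obtain rfl : Γ *ᵥ y = x := congrArg Subtype.val hy
  exact hW a y y.2

theorem reachableSubspace_weightedStep_eq_top (hΓ : IsUnit Γ)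
    (hd : (Set.range d).SeparatesPoints) (he : d e = 1) :
    reachableSubspace (fun a => weightedStep Γ (d a)) 1 (Fintype.card n) = ⊤ := by
  rw [← finrank_fintype_fun_eq_card 𝕜]
  refine reachableSubspace_finrank_eq_top fun W h1 hW => eq_top_iff.2 fun g _ => ?_
  simpa using mul_mem_of_forall_weightedStep_mem hΓ hd he hW g h1

theorem unobservableSubspace_weightedStep_eq_bot (hΓ : IsUnit Γ)
    (hd : (Set.range d).SeparatesPoints) (he : d e = 1) {p : n → 𝕜} (hp : ∀ k, p k ≠ 0) :
    unobservableSubspace (fun a => weightedStep Γ (d a)) (dotProductEquiv 𝕜 n p)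
      (Fintype.card n) = ⊥ := by
  rw [← finrank_fintype_fun_eq_card 𝕜]
  refine unobservableSubspace_finrank_eq_bot fun W hker hW => W.eq_bot_iff.2 fun x hx => ?_
  ext k
  have := hker (mul_mem_of_forall_weightedStep_mem hΓ hd he hW (Pi.single k 1) hx)
  simpa [← Pi.single_mul_left, hp] using this

theorem exists_perm_of_weightedStep_words_eq (hΓ : IsUnit Γ) {Γ' : Matrix n n 𝕜}
    {p p' : n → 𝕜} (hp : ∀ k, p k ≠ 0) (hd : (Set.range d).SeparatesPoints) {d' : ι → n → 𝕜}
    (he : d e = 1) (he' : d' e = 1)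
    (h : ∀ w : List ι, w.length < 2 * Fintype.card n →
      p ⬝ᵥ (w.map fun a => weightedStep Γ (d a)).prod 1 =
        p' ⬝ᵥ (w.map fun a => weightedStep Γ' (d' a)).prod 1) :
    ∃ σ : Equiv.Perm n, (∀ j k, Γ' j k = Γ (σ j) (σ k)) ∧ ∀ a, d' a = d a ∘ σ := by
  obtain ⟨T, hT1, hT⟩ := exists_linearEquiv_intertwining rfl
    (reachableSubspace_weightedStep_eq_top hΓ hd he)
    (unobservableSubspace_weightedStep_eq_bot hΓ hd he hp) (φ' := dotProductEquiv 𝕜 n p') h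
  have hTΓ (x : n → 𝕜) : T (Γ *ᵥ x) = Γ' *ᵥ T x := by simpa [he, he'] using hT e x
  have hTd (a : ι) (x : n → 𝕜) : T (d a * x) = d' a * T x := by
    obtain ⟨y, rfl⟩ := Matrix.mulVec_surjective_iff_isUnit.2 hΓ x
    rw [hTΓ]
    exact hT a y
  obtain ⟨σ, hσ, hσd⟩ := exists_perm_of_linearEquiv_mul hT1 hd hTd
  refine ⟨σ, fun j k => ?_, hσd⟩
  have hsingle : Pi.single (σ k) (1 : 𝕜) ∘ σ = Pi.single k 1 := by
    ext i
    simp [Pi.single_apply]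
  have := congrFun (hTΓ (Pi.single (σ k) 1)) j
  simpa [hσ, hsingle] using this.symm

end WeightedStep

section MarkovChain

theorem integral_comp_eq_sum_measureReal_preimage {Ω α : Type*} [MeasurableSpace Ω] [Fintype α]
    [MeasurableSpace α] [MeasurableSingletonClass α] {μ : Measure Ω} [IsFiniteMeasure μ]
    {Z : Ω → α} (hZ : Measurable Z) (g : α → ℝ) :
    ∫ ω, g (Z ω) ∂μ = ∑ z, μ.real (Z ⁻¹' {z}) * g z := by
  rw [← integral_map hZ.aemeasurable Measurable.of_discrete.aestronglyMeasurable,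
    integral_fintype .of_finite]
  simp only [map_measureReal_apply hZ (measurableSet_singleton _), smul_eq_mul]

variable {K n : ℕ} {Ω : Type*} [MeasurableSpace Ω] {Γ : Matrix (Fin K) (Fin K) ℝ}
  {μ : Measure Ω} {X : ℕ → Ω → Fin K}

theorem IsMarkovChain.measureReal_path_succ (h : IsMarkovChain Γ μ X) (x : Fin (n + 1) → Fin K)
    (y : Fin K) :
    μ.real ((fun ω => (fun i : Fin (n + 1) => X i ω, X (n + 1) ω)) ⁻¹' {(x, y)}) =
      μ.real ((fun ω (i : Fin (n + 1)) => X i ω) ⁻¹' {x}) * Γ (x (Fin.last n)) y := by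
  let z : ℕ → Fin K := Function.extend Fin.val x fun _ => y
  have hzx (i : Fin (n + 1)) : z i = x i := Fin.val_injective.extend_apply _ _ i
  have hzy : z (n + 1) = y := Function.extend_apply' _ _ _ fun ⟨i, hi⟩ => i.2.ne hi
  have hpath (ω : Ω) : (∀ i ≤ n, X i ω = z i) ↔ ∀ i : Fin (n + 1), X i ω = x i := by
    simp only [← hzx, Fin.forall_iff, Nat.lt_succ_iff]
  have hpath_succ (ω : Ω) : (∀ i ≤ n + 1, X i ω = z i) ↔
      (∀ i : Fin (n + 1), X i ω = x i) ∧ X (n + 1) ω = y := by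
    rw [← hpath, ← hzy]
    simpa only [Nat.lt_succ_iff] using
      Nat.forall_lt_succ_right (n := n + 1) (p := fun i => X i ω = z i)
  have hlast : z n = x (Fin.last n) := hzx (Fin.last n)
  have key := h.markov n z
  simp only [hpath, hpath_succ, hzy, hlast] at key
  convert key using 3 <;> ext ω <;> simp [funext_iff]

variable [IsFiniteMeasure μ]

theorem IsMarkovChain.integral_mul_succ (h : IsMarkovChain Γ μ X)
    (G : (Fin (n + 1) → Fin K) → ℝ) (g : Fin K → ℝ) :
    ∫ ω, G (fun i => X i ω) * g (X (n + 1) ω) ∂μ =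
      ∫ ω, G (fun i => X i ω) * (Γ *ᵥ g) (X n ω) ∂μ := by
  have hmeas : Measurable fun ω (i : Fin (n + 1)) => X i ω :=
    measurable_pi_lambda _ fun i => h.measurable i
  calc ∫ ω, G (fun i => X i ω) * g (X (n + 1) ω) ∂μ
    _ = ∑ x, ∑ y, μ.real ((fun ω (i : Fin (n + 1)) => X i ω) ⁻¹' {x}) * Γ (x (Fin.last n)) y *
          (G x * g y) := by
      rw [integral_comp_eq_sum_measureReal_preimage (hmeas.prodMk (h.measurable (n + 1)))
        fun z => G z.1 * g z.2, Fintype.sum_prod_type]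
      simp only [h.measureReal_path_succ]
    _ = ∑ x, μ.real ((fun ω (i : Fin (n + 1)) => X i ω) ⁻¹' {x}) *
          (G x * (Γ *ᵥ g) (x (Fin.last n))) := by
      simp only [mulVec, dotProduct, Finset.mul_sum]
      refine Finset.sum_congr rfl fun x _ => Finset.sum_congr rfl fun y _ => ?_
      ring
    _ = ∫ ω, G (fun i => X i ω) * (Γ *ᵥ g) (X n ω) ∂μ :=
      (integral_comp_eq_sum_measureReal_preimage hmeas
        fun x => G x * (Γ *ᵥ g) (x (Fin.last n))).symm

theorem IsMarkovChain.integral_prod_mul_eq_dotProduct (h : IsMarkovChain Γ μ X)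
    (f : Fin n → Fin K → ℝ) (g : Fin K → ℝ) :
    ∫ ω, (∏ i, f i (X i ω)) * g (X n ω) ∂μ =
      (fun k => μ.real (X 0 ⁻¹' {k})) ⬝ᵥ (List.ofFn fun i => weightedStep Γ (f i)).prod g := by
  induction n generalizing g with
  | zero =>
    simpa [dotProduct] using integral_comp_eq_sum_measureReal_preimage (h.measurable 0) g
  | succ n ih =>
    calc ∫ ω, (∏ i, f i (X i ω)) * g (X (n + 1) ω) ∂μ
      _ = ∫ ω, (∏ i, f i (X i ω)) * (Γ *ᵥ g) (X n ω) ∂μ :=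
        h.integral_mul_succ (fun x => ∏ i, f i (x i)) g
      _ = ∫ ω, (∏ i : Fin n, f i.castSucc (X i ω)) *
            weightedStep Γ (f (Fin.last n)) g (X n ω) ∂μ := by
        simp only [Fin.prod_univ_castSucc, Fin.val_castSucc, Fin.val_last, weightedStep_apply,
          Pi.mul_apply, mul_assoc]
      _ = _ := by
        rw [ih, List.ofFn_succ', List.concat_eq_append, List.prod_append, List.prod_singleton,
          Module.End.mul_apply]

end MarkovChain

section HiddenMarkovModel

/-- The probability of an observation in `A` as a function of the state `k`, when the
state-dependent distributions are `F k`. -/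
noncomputable def emissionProb {ι S : Type*} [MeasurableSpace S] (F : ι → Measure S)
    (A : {A : Set S // MeasurableSet A}) (k : ι) : ℝ :=
  (F k).real A

variable {K n N : ℕ} {S Ω : Type*} [MeasurableSpace S] [MeasurableSpace Ω]
  {Γ : Matrix (Fin K) (Fin K) ℝ} {F : Fin K → Measure S} {μ : Measure Ω} [IsFiniteMeasure μ]
  {X : ℕ → Ω → Fin K} {Y : ℕ → Ω → S}

theorem IsHiddenMarkovModel.measureReal_iInter_preimage (h : IsHiddenMarkovModel Γ F μ X Y)
    (s : Finset ℕ) {B : ℕ → Set S} (hB : ∀ t, MeasurableSet (B t)) :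
    μ.real (⋂ t ∈ s, Y t ⁻¹' B t) = ∫ ω, ∏ t ∈ s, (F (X t ω)).real (B t) ∂μ := by
  have hX : processSigma X ≤ ‹MeasurableSpace Ω› :=
    iSup_le fun t => (h.markovChain.measurable t).comap_le
  have hY : MeasurableSet (⋂ t ∈ s, Y t ⁻¹' B t) :=
    s.measurableSet_biInter fun t _ => h.measurable t (hB t)
  calc μ.real (⋂ t ∈ s, Y t ⁻¹' B t)
    _ = ∫ ω, (μ⟦⋂ t ∈ s, Y t ⁻¹' B t | processSigma X⟧) ω ∂μ := by
      exact ((integral_condExp hX).trans (integral_indicator_one hY)).symm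
    _ = ∫ ω, ∏ t ∈ s, (F (X t ω)).real (B t) ∂μ := by
      refine integral_congr_ae ?_
      filter_upwards [h.condIndep s B hB, ae_all_iff.2 fun t => h.condDistrib t (B t) (hB t)]
        with ω hprod hF
      simp only [hprod, hF]

theorem IsHiddenMarkovModel.map_measureReal_pi (h : IsHiddenMarkovModel Γ F μ X Y)
    (B : Fin n → {A : Set S // MeasurableSet A}) :
    (μ.map fun ω (i : Fin n) => Y i ω).real (Set.univ.pi fun i => B i) =
      (fun k => μ.real (X 0 ⁻¹' {k})) ⬝ᵥ
        (List.ofFn fun i => weightedStep Γ (emissionProb F (B i))).prod 1 := by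
  let C : ℕ → {A : Set S // MeasurableSet A} :=
    Function.extend Fin.val B fun _ => ⟨Set.univ, .univ⟩
  have hCB (i : Fin n) : C i = B i := Fin.val_injective.extend_apply _ _ i
  calc (μ.map fun ω (i : Fin n) => Y i ω).real (Set.univ.pi fun i => B i)
    _ = μ.real (⋂ t ∈ Finset.range n, Y t ⁻¹' C t) := by
      rw [map_measureReal_apply (measurable_pi_lambda _ fun i : Fin n => h.measurable i)
        (.pi Set.countable_univ fun i _ => (B i).2)]
      congr 1
      ext ω
      simp [Fin.forall_iff, ← hCB]
    _ = ∫ ω, ∏ i : Fin n, emissionProb F (B i) (X i ω) ∂μ := by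
      rw [h.measureReal_iInter_preimage _ fun t => (C t).2]
      simp only [Finset.prod_range, hCB, emissionProb]
    _ = _ := by
      simpa using h.markovChain.integral_prod_mul_eq_dotProduct (fun i => emissionProb F (B i)) 1

theorem IsHiddenMarkovModel.map_measureReal_word (h : IsHiddenMarkovModel Γ F μ X Y)
    (w : List {A : Set S // MeasurableSet A}) :
    (μ.map fun ω (i : Fin w.length) => Y i ω).real (Set.univ.pi fun i => w.get i) =
      (fun k => μ.real (X 0 ⁻¹' {k})) ⬝ᵥ
        (w.map fun A => weightedStep Γ (emissionProb F A)).prod 1 := by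
  rw [h.map_measureReal_pi w.get]
  conv_rhs => rw [← List.ofFn_get w, List.map_ofFn]
  rfl

end HiddenMarkovModel

section Identification

theorem map_comp_castLE {n N : ℕ} {S Ω : Type*} [MeasurableSpace S] [MeasurableSpace Ω]
    {μ : Measure Ω} {Y : ℕ → Ω → S} (hY : ∀ t, Measurable (Y t)) (hn : n ≤ N) :
    (μ.map fun ω (i : Fin N) => Y i ω).map (fun y i => y (Fin.castLE hn i)) =
      μ.map fun ω (i : Fin n) => Y i ω :=
  Measure.map_map (measurable_pi_lambda _ fun _ => measurable_pi_apply _)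
    (measurable_pi_lambda _ fun i => hY i)

theorem separatesPoints_range_emissionProb {ι S : Type*} [MeasurableSpace S] {F : ι → Measure S}
    [∀ k, IsFiniteMeasure (F k)] (hF : Function.Injective F) :
    (Set.range (emissionProb F)).SeparatesPoints := by
  intro j k hjk
  by_contra! h
  exact hjk <| hF <| Measure.ext fun A hA =>
    (measureReal_eq_measureReal_iff).1 (h _ ⟨⟨A, hA⟩, rfl⟩)

theorem isUnit_of_rank_eq_card {𝕜 n : Type*} [Field 𝕜] [Fintype n] [DecidableEq n]
    {A : Matrix n n 𝕜} (hA : A.rank = Fintype.card n) : IsUnit A := by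
  have hrange : LinearMap.range A.mulVecLin = ⊤ :=
    Submodule.eq_top_of_finrank_eq (hA.trans (finrank_fintype_fun_eq_card 𝕜).symm)
  exact mulVec_surjective_iff_isUnit.1 (LinearMap.range_eq_top.1 hrange)

theorem IsStationaryDistribution.vecMul_pow_eq {K : ℕ} {Γ : Matrix (Fin K) (Fin K) ℝ}
    {p : Fin K → ℝ} (h : IsStationaryDistribution Γ p) (n : ℕ) : p ᵥ* Γ ^ n = p := by
  induction n with
  | zero => simp
  | succ n ih => rw [pow_succ, ← vecMul_vecMul, ih, h.vecMul_eq]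

theorem IsStationaryDistribution.pos {K : ℕ} {Γ : Matrix (Fin K) (Fin K) ℝ} {p : Fin K → ℝ}
    (h : IsStationaryDistribution Γ p) (hΓ : Γ.IsIrreducible) (j : Fin K) : 0 < p j := by
  obtain ⟨i, -, hi⟩ : ∃ i ∈ Finset.univ, 0 < p i :=
    (Finset.sum_pos_iff_of_nonneg fun k _ => h.nonneg k).1 (h.sum_eq_one ▸ one_pos)
  obtain ⟨n, -, hn⟩ := (isIrreducible_iff_exists_pow_pos hΓ.nonneg).1 hΓ i j
  rw [← h.vecMul_pow_eq n]
  exact Finset.sum_pos'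
    (fun k _ => mul_nonneg (h.nonneg k) (pow_apply_nonneg hΓ.nonneg n k j))
    ⟨i, Finset.mem_univ i, mul_pos hi hn⟩

end Identification

theorem mainTheorem2_general {K N : ℕ} {S Ω Ω' : Type*} [MeasurableSpace S] [MeasurableSpace Ω]
    [MeasurableSpace Ω'] {μ : Measure Ω} {μ' : Measure Ω'} [IsFiniteMeasure μ]
    [IsFiniteMeasure μ'] {X : ℕ → Ω → Fin K} {Y : ℕ → Ω → S} {X' : ℕ → Ω' → Fin K}
    {Y' : ℕ → Ω' → S} {Γ Γ' : Matrix (Fin K) (Fin K) ℝ} {F F' : Fin K → Measure S}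
    (hmm : IsHiddenMarkovModel Γ F μ X Y) (hmm' : IsHiddenMarkovModel Γ' F' μ' X' Y')
    (hΓ : IsUnit Γ) (hF : Function.Injective F) (hinit : ∀ k, μ.real (X 0 ⁻¹' {k}) ≠ 0)
    (hN : 2 * K ≤ N + 1)
    (hlaw : μ.map (fun ω (i : Fin N) => Y i ω) = μ'.map (fun ω (i : Fin N) => Y' i ω)) :
    EqualUpToLabelSwapping Γ F Γ' F' := by
  have := hmm.isProbabilityMeasure
  have := hmm'.isProbabilityMeasure
  have hword (w : List {A : Set S // MeasurableSet A}) (hw : w.length < 2 * Fintype.card (Fin K)) :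
      (fun k => μ.real (X 0 ⁻¹' {k})) ⬝ᵥ
          (w.map fun A => weightedStep Γ (emissionProb F A)).prod 1 =
        (fun k => μ'.real (X' 0 ⁻¹' {k})) ⬝ᵥ
          (w.map fun A => weightedStep Γ' (emissionProb F' A)).prod 1 := by
    have hwN : w.length ≤ N := by
      rw [Fintype.card_fin] at hw
      lia
    rw [← hmm.map_measureReal_word, ← hmm'.map_measureReal_word,
      ← map_comp_castLE hmm.measurable hwN, ← map_comp_castLE hmm'.measurable hwN, hlaw]
  obtain ⟨σ, hσΓ, hσF⟩ := exists_perm_of_weightedStep_words_eq hΓ hinit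
    (separatesPoints_range_emissionProb hF) (e := ⟨Set.univ, .univ⟩) (by ext; simp [emissionProb])
    (by ext; simp [emissionProb]) hword
  refine ⟨σ, hσΓ, fun k => Measure.ext fun A hA => ?_⟩
  exact (measureReal_eq_measureReal_iff).1 (congrFun (hσF ⟨A, hA⟩) k)

theorem mainTheorem2 {K q : ℕ} (S : Set (EuclideanSpace ℝ (Fin q)))
    {Ω Ω' : Type*} [MeasurableSpace Ω] [MeasurableSpace Ω']
    (μ : Measure Ω) (μ' : Measure Ω') [IsProbabilityMeasure μ] [IsProbabilityMeasure μ']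
    (X : ℕ → Ω → Fin K) (Y : ℕ → Ω → S) (X' : ℕ → Ω' → Fin K) (Y' : ℕ → Ω' → S)
    (Γ Γ' : Matrix (Fin K) (Fin K) ℝ) (F F' : Fin K → Measure S)
    (hmm : IsHiddenMarkovModel Γ F μ X Y) (hmm' : IsHiddenMarkovModel Γ' F' μ' X' Y')
    (hΓ : FullRankErgodic Γ) (hΓ' : FullRankErgodic Γ')
    (hF : Function.Injective F) (hF' : Function.Injective F')
    (hstat : StartsStationary Γ μ X) (hstat' : StartsStationary Γ' μ' X')
    (hlaw : μ.map (fun ω (i : Fin (2 * K + 1)) => Y i ω) =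
      μ'.map (fun ω (i : Fin (2 * K + 1)) => Y' i ω)) :
    EqualUpToLabelSwapping Γ F Γ' F' :=
  mainTheorem2_general hmm hmm' (isUnit_of_rank_eq_card (hΓ.1.trans (Fintype.card_fin K).symm)) hF
    (fun k => (hstat.pos hΓ.2.1 k).ne') (by lia) hlaw
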